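/- Let $S$ be an infinite semigroup. For each finite coloring of $S$ (that is, each map $\chi : S \to C$ into a finite set $C$ of colors), there are distinct elements $a_1, a_2, \dots$ of $S$, and a finite subset $F$ of the (infinite) set of finite products $$\mathrm{FP}(a_1,a_2,\dots)=\{\, a_{i_1}a_{i_2}\cdots a_{i_m} : m\ge 1,\ i_1<i_2<\cdots<i_m \,\},$$ such that all elements of $\mathrm{FP}(a_1,a_2,\dots)\setminus F$ have the same color. -/

import Mathlib

open Filter Set

attribute [local instance] Ultrafilter.mul Ultrafilter.semigroup

/-! For a free ultrafilter U on S, some color class lies in U. If UU = U, the Galvin–Glazer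
construction, kept injective by freeness, puts all finite products in that class. If UU is principal
at s, choose distinct terms in the class with a_i a_j = s for i < j; products of two or more terms
then lie in a finite set if s has finite order, and otherwise the powers of s carry a free
idempotent.

One of the two kinds of U exists. If not, idempotents are principal and squares of free ultrafilters
are free. A minimal compact subsemigroup with a free member U then forces UU = uU for some u in S.
Either the powers of u carry a free idempotent, or the uⁿU form a finite semigroup of free
ultrafilters, which contains an idempotent. -/

namespace Ultrafilter

/-- An ultrafilter which is not concentrated at a point. -/
def IsFree {S : Type*} (U : Ultrafilter S) : Prop := ∀ x : S, U ≠ pure x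

theorem eq_pure_of_eventually_eq {S : Type*} {U : Ultrafilter S} {x : S}
    (h : ∀ᶠ y in U, y = x) : U = pure x :=
  Ultrafilter.coe_le_coe.1 (le_pure_iff.2 h)

theorem IsFree.eventually_ne {S : Type*} {U : Ultrafilter S} (hU : U.IsFree) (x : S) :
    ∀ᶠ y in U, y ≠ x := by
  by_contra h
  rw [Ultrafilter.eventually_not, not_not] at h
  exact hU x (eq_pure_of_eventually_eq h)

theorem isClosed_setOf_isFree (S : Type*) : IsClosed {U : Ultrafilter S | U.IsFree} := by
  have h : {U : Ultrafilter S | U.IsFree} = ⋂ x : S, {U | {x}ᶜ ∈ U} := by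
    ext U
    simp only [mem_ofPred_eq, mem_iInter]
    refine ⟨fun hU x => hU.eventually_ne x, fun hU x hx => ?_⟩
    have := hU x
    rw [hx] at this
    exact mem_pure.1 this rfl
  rw [h]
  exact isClosed_iInter fun x => ultrafilter_isClosed_basic _

theorem exists_isFree_mem {S : Type*} {A : Set S} (hA : A.Infinite) :
    ∃ U : Ultrafilter S, U.IsFree ∧ A ∈ U := by
  have := (cofinite_inf_principal_neBot_iff).2 hA
  refine ⟨Ultrafilter.of (cofinite ⊓ 𝓟 A), fun x hx => ?_, ?_⟩
  · have h : ({x}ᶜ : Set S) ∈ Ultrafilter.of (cofinite ⊓ 𝓟 A) :=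
      Ultrafilter.of_le _ (mem_inf_of_left (finite_singleton x).compl_mem_cofinite)
    rw [hx] at h
    exact mem_pure.1 h rfl
  · exact Ultrafilter.of_le _ (mem_inf_of_right (mem_principal_self A))

theorem pure_mul_pure {S : Type*} [Mul S] (x y : S) :
    (pure x * pure y : Ultrafilter S) = pure (x * y) := rfl

theorem eventually_eventually_of_mul_eq_pure {S : Type*} [Mul S] {U V : Ultrafilter S} {s : S}
    (h : U * V = pure s) : ∀ᶠ x in U, ∀ᶠ y in V, x * y = s := by
  rw [← Ultrafilter.eventually_mul U V (fun m => m = s), h]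
  exact mem_pure.2 rfl

end Ultrafilter

section Powers

variable {S : Type*} [Semigroup S]

/-- With no identity available, `(u * ·)^[n] u` serves as the power uⁿ⁺¹. -/
theorem mul_left_iterate_mul (u x y : S) (n : ℕ) :
    (u * ·)^[n] x * y = (u * ·)^[n] (x * y) := by
  induction n with
  | zero => rfl
  | succ n ih => rw [Function.iterate_succ_apply', Function.iterate_succ_apply', mul_assoc, ih]

theorem mul_left_iterate_self_mul (u x : S) (n : ℕ) :
    (u * ·)^[n] u * x = (u * ·)^[n + 1] x := by
  rw [mul_left_iterate_mul, Function.iterate_succ_apply]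

theorem finite_range_iterate {α : Type*} {f : α → α} {x : α}
    (h : ¬ Function.Injective fun n => f^[n] x) : (range fun n => f^[n] x).Finite := by
  obtain ⟨k, l, hkl, hlt⟩ : ∃ k l, f^[k] x = f^[l] x ∧ k < l := by
    simp only [Function.Injective, not_forall] at h
    obtain ⟨k, l, h, hne⟩ := h
    rcases lt_or_gt_of_ne hne with hlt | hlt
    exacts [⟨k, l, h, hlt⟩, ⟨l, k, h.symm, hlt⟩]
  refine ((finite_Iio l).image fun n => f^[n] x).subset ?_
  rintro _ ⟨n, rfl⟩
  induction n using Nat.strong_induction_on with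
  | _ n ih =>
    rcases lt_or_ge n l with hn | hn
    · exact ⟨n, hn, rfl⟩
    · have hx : f^[n] x = f^[n - l + k] x := by
        conv_lhs => rw [← Nat.sub_add_cancel hn, Function.iterate_add_apply, ← hkl]
        rw [← Function.iterate_add_apply]
      simp only [hx]
      exact ih _ (by omega)

/-- The powers of an element of infinite order carry a free idempotent ultrafilter. -/
theorem exists_isFree_idempotent_of_infinite_powers {u : S}
    (hu : (range fun n => (u * ·)^[n] u).Infinite) :
    ∃ U : Ultrafilter S, U.IsFree ∧ U * U = U := by
  set P := range fun n => (u * ·)^[n] u with hP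
  have hinj : Function.Injective fun n => (u * ·)^[n] u := by
    by_contra h
    exact hu (finite_range_iterate h)
  have hmul : ∀ U ∈ {U : Ultrafilter S | U.IsFree} ∩ {U | P ∈ U},
      ∀ V ∈ {U : Ultrafilter S | U.IsFree} ∩ {U | P ∈ U},
      U * V ∈ {U : Ultrafilter S | U.IsFree} ∩ {U | P ∈ U} := by
    rintro U ⟨hU, hPU⟩ V ⟨hV, hPV⟩
    refine ⟨fun z hz => ?_, ?_⟩
    -- Powers of infinite order cancel, so xy = z would pin y to one value, against freeness of V.
    · obtain ⟨x, hx, i, rfl⟩ :=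
        ((Ultrafilter.eventually_eventually_of_mul_eq_pure hz).and hPU).exists
      obtain ⟨y, hy, j, rfl⟩ := (hx.and hPV).exists
      obtain ⟨y', ⟨hy', hne⟩, j', rfl⟩ := ((hx.and (hV.eventually_ne _)).and hPV).exists
      have h := hy.trans hy'.symm
      simp only [mul_left_iterate_self_mul, ← Function.iterate_add_apply] at h
      have := hinj h
      apply hne
      rw [show j' = j by omega]
    · change ∀ᶠ m in (U * V : Ultrafilter S), m ∈ P
      rw [Ultrafilter.eventually_mul]
      filter_upwards [hPU] with x hx
      filter_upwards [hPV] with y hy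
      obtain ⟨i, rfl⟩ := hx
      obtain ⟨j, rfl⟩ := hy
      exact ⟨i + 1 + j, by simp only [mul_left_iterate_self_mul, ← Function.iterate_add_apply]⟩
  obtain ⟨U, ⟨hU, -⟩, hUU⟩ := exists_idempotent_in_compact_subsemigroup
    (M := Ultrafilter S) Ultrafilter.continuous_mul_left
    ({U | U.IsFree} ∩ {U | P ∈ U}) (Ultrafilter.exists_isFree_mem hu)
    ((Ultrafilter.isClosed_setOf_isFree S).inter (ultrafilter_isClosed_basic P)).isCompact hmul
  exact ⟨U, hU, hUU⟩

end Powers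

section Existence

/-- There is a minimal compact subsemigroup of `βS` among those that contain a free ultrafilter. -/
theorem exists_minimal_compact_subsemigroup_isFree (S : Type*) [Semigroup S] [Infinite S] :
    ∃ T : Set (Ultrafilter S), Minimal (fun T : Set (Ultrafilter S) =>
      IsClosed T ∧ (∀ U ∈ T, ∀ V ∈ T, U * V ∈ T) ∧ (T ∩ {U | U.IsFree}).Nonempty) T := by
  refine (zorn_superset_nonempty
    {T : Set (Ultrafilter S) | IsClosed T ∧ (∀ U ∈ T, ∀ V ∈ T, U * V ∈ T) ∧
      (T ∩ {U | U.IsFree}).Nonempty} ?_ univ ?_).imp fun T hT => hT.2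
  · intro c hc hchain hne
    refine ⟨⋂₀ c, ⟨isClosed_sInter fun t ht => (hc ht).1, fun U hU V hV t ht =>
      (hc ht).2.1 U (hU t ht) V (hV t ht), ?_⟩, fun t ht => sInter_subset_of_mem ht⟩
    have : Nonempty c := hne.to_subtype
    have h := IsCompact.nonempty_iInter_of_directed_nonempty_isCompact_isClosed
      (fun t : c => (t : Set (Ultrafilter S)) ∩ {U | U.IsFree}) ?_ (fun t => (hc t.2).2.2)
      (fun t => ((hc t.2).1.inter (Ultrafilter.isClosed_setOf_isFree S)).isCompact)
      (fun t => (hc t.2).1.inter (Ultrafilter.isClosed_setOf_isFree S))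
    · obtain ⟨U, hU⟩ := h
      rw [mem_iInter] at hU
      exact ⟨U, fun t ht => (hU ⟨t, ht⟩).1, (hU (Classical.arbitrary c)).2⟩
    · intro s t
      rcases hchain.total s.2 t.2 with h | h
      · exact ⟨s, subset_rfl, inter_subset_inter_left _ h⟩
      · exact ⟨t, inter_subset_inter_left _ h, subset_rfl⟩
  · obtain ⟨U, hU, -⟩ := Ultrafilter.exists_isFree_mem (infinite_univ (α := S))
    exact ⟨isClosed_univ, fun _ _ _ _ => mem_univ _, U, mem_univ _, hU⟩

/-- If `U * U = u * U` with `u` of finite order, then some power of `U` is idempotent. -/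
theorem exists_isFree_idempotent_of_mul_self_eq {S : Type*} [Semigroup S] {U : Ultrafilter S} {u : S}
    (hU : U * U = pure u * U) (hu : (range fun n => (u * ·)^[n] u).Finite) (hfree : U.IsFree)
    (hsq : ∀ V : Ultrafilter S, V.IsFree → (V * V).IsFree) :
    ∃ V : Ultrafilter S, V.IsFree ∧ V * V = V := by
  set W : ℕ → Ultrafilter S := fun n => (pure u * ·)^[n] U with hW
  have W_succ (n : ℕ) : W (n + 1) = pure u * W n := Function.iterate_succ_apply' _ _ _
  have U_mul (n : ℕ) : U * W n = W (n + 1) := by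
    induction n with
    | zero => exact hU
    | succ n ih =>
      rw [W_succ (n + 1), ← ih, ← mul_assoc, ← mul_assoc, ← hU]
  have W_mul (m n : ℕ) : W m * W n = W (m + (n + 1)) := by
    simp only [hW]
    rw [mul_left_iterate_mul, Function.iterate_add_apply]
    exact congrArg _ (U_mul n)
  have W_free_of_le {m n : ℕ} (h : m ≤ n) (hn : (W n).IsFree) : (W m).IsFree := by
    induction n, h using Nat.le_induction with
    | base => exact hn
    | succ n _ ih =>
      refine ih fun x hx => hn (u * x) ?_
      rw [W_succ, hx, Ultrafilter.pure_mul_pure]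
  -- Freeness passes to smaller indices, and squaring jumps from n to 2n + 1.
  have W_free (n : ℕ) : (W n).IsFree := by
    induction n with
    | zero => exact hfree
    | succ n ih =>
      refine W_free_of_le (n := n + (n + 1)) (by omega) ?_
      rw [← W_mul]
      exact hsq _ ih
  have hpow (n : ℕ) : (pure ((u * ·)^[n] u) : Ultrafilter S) * U = W (n + 1) := by
    induction n with
    | zero => rfl
    | succ n ih =>
      rw [W_succ, ← ih, Function.iterate_succ_apply', ← mul_assoc, Ultrafilter.pure_mul_pure]
  have hfin : (range W).Finite := by
    refine ((hu.image fun x => pure x * U).insert U).subset ?_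
    rintro _ ⟨n | n, rfl⟩
    · exact mem_insert _ _
    · exact mem_insert_of_mem _ ⟨_, ⟨n, rfl⟩, hpow n⟩
  obtain ⟨_, ⟨n, rfl⟩, h⟩ := exists_idempotent_in_compact_subsemigroup
    (M := Ultrafilter S) Ultrafilter.continuous_mul_left (range W) (range_nonempty W)
    hfin.isCompact (by rintro _ ⟨m, rfl⟩ _ ⟨n, rfl⟩; exact ⟨_, (W_mul m n).symm⟩)
  exact ⟨W n, W_free n, h⟩

/-- Every infinite semigroup carries a free ultrafilter that is idempotent, or one whose square is
principal. -/
theorem exists_isFree_idempotent_or_mul_self_eq_pure (S : Type*) [Semigroup S] [Infinite S] :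
    (∃ U : Ultrafilter S, U.IsFree ∧ U * U = U) ∨
      ∃ U : Ultrafilter S, U.IsFree ∧ ∃ s : S, U * U = pure s := by
  by_contra! hcon
  obtain ⟨hid, hsq⟩ := hcon
  have principal {V : Ultrafilter S} (hV : V * V = V) : ∃ x, V = pure x := by
    by_contra! h
    exact hid V h hV
  obtain ⟨T, ⟨hTc, hTm, U, hUT, hU⟩, hmin⟩ := exists_minimal_compact_subsemigroup_isFree S
  -- TU is a compact subsemigroup of T containing the free UU, so minimality gives TU = T.
  have hTU : T ⊆ (· * U) '' T := by
    refine hmin ⟨?_, ?_, U * U, ⟨U, hUT, rfl⟩, hsq U hU⟩ ?_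
    · exact (hTc.isCompact.image (Ultrafilter.continuous_mul_left U)).isClosed
    · rintro _ ⟨V, hV, rfl⟩ _ ⟨W, hW, rfl⟩
      exact ⟨V * U * W, hTm _ (hTm _ hV _ hUT) _ hW, mul_assoc _ _ _⟩
    · rintro _ ⟨V, hV, rfl⟩
      exact hTm _ hV _ hUT
  obtain ⟨E, ⟨hET, hEU⟩, hEE⟩ := exists_idempotent_in_compact_subsemigroup
    (M := Ultrafilter S) Ultrafilter.continuous_mul_left (T ∩ (· * U) ⁻¹' {U})
    (by obtain ⟨V, hV, h⟩ := hTU hUT; exact ⟨V, hV, h⟩)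
    (hTc.inter (isClosed_singleton.preimage (Ultrafilter.continuous_mul_left U))).isCompact
    (by
      rintro V ⟨hV, hVU⟩ W ⟨hW, hWU⟩
      simp only [mem_preimage, mem_singleton_iff] at hVU hWU
      exact ⟨hTm _ hV _ hW, by simp only [mem_preimage, mem_singleton_iff, mul_assoc, hWU, hVU]⟩)
  simp only [mem_preimage, mem_singleton_iff] at hEU
  obtain ⟨e, rfl⟩ := principal hEE
  obtain ⟨V₀, -, hV₀⟩ := hTU hET
  simp only at hV₀
  obtain ⟨V, hVU, hEV⟩ : ∃ V : Ultrafilter S, V * U = pure e ∧ pure e * V = V :=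
    ⟨pure e * V₀, by rw [mul_assoc, hV₀, hEE], by rw [← mul_assoc, hEE]⟩
  -- UVUV = UeV = UV, so UV is idempotent.
  obtain ⟨f, hf⟩ := principal (V := U * V)
    (by rw [mul_assoc, ← mul_assoc V, hVU, hEV])
  obtain ⟨u, hu⟩ : ∃ u, pure f * U = pure u := by
    obtain ⟨x, hx⟩ := (Ultrafilter.eventually_eventually_of_mul_eq_pure hf).exists
    obtain ⟨y, hxy, hy⟩ :=
      (hx.and (Ultrafilter.eventually_eventually_of_mul_eq_pure hVU)).exists
    refine ⟨x * e, Ultrafilter.eq_pure_of_eventually_eq ?_⟩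
    rw [Ultrafilter.eventually_mul]
    refine mem_pure.2 ?_
    filter_upwards [hy] with z hz
    rw [← hxy, mul_assoc, hz]
  have hUU : U * U = pure u * U := by
    rw [← hu, ← hf, mul_assoc U V U, hVU, mul_assoc, hEU]
  by_cases hfin : (range fun n => (u * ·)^[n] u).Finite
  · obtain ⟨W, hW, h⟩ := exists_isFree_idempotent_of_mul_self_eq hUU hfin hU hsq
    exact hid W hW h
  · obtain ⟨W, hW, h⟩ := exists_isFree_idempotent_of_infinite_powers hfin
    exact hid W hW h

end Existence

namespace Hindman

variable {S : Type*} [Semigroup S]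

/-- A set that is large for a free idempotent ultrafilter contains the finite products of a sequence
of distinct elements. -/
theorem exists_injective_FP_subset {U : Ultrafilter S} (hU : U.IsFree) (hUU : U * U = U)
    {A : Set S} (hA : A ∈ U) : ∃ a : Stream' S, Function.Injective a.get ∧ FP a ⊆ A := by
  -- Each term is paired with a large set. Later sets lie inside it, omit the term, and stay inside
  -- after left multiplication by it.
  obtain ⟨f, hf, hr⟩ := exists_seq_of_forall_finset_exists
    (fun p : S × Set S => p.2 ⊆ A ∧ p.1 ∈ p.2 ∧ p.2 ∈ U ∧ ∀ᶠ m in U, p.1 * m ∈ p.2)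
    (fun p q => ∀ m ∈ q.2, m ∈ p.2 ∧ m ≠ p.1 ∧ p.1 * m ∈ p.2) (by
      intro s hs
      set B : Set S := A ∩ {m | ∀ p ∈ s, m ∈ p.2 ∧ m ≠ p.1 ∧ p.1 * m ∈ p.2}
      have hB : B ∈ U := by
        refine inter_mem hA ((eventually_all_finset s).2 fun p hp => ?_)
        obtain ⟨-, -, h₁, h₂⟩ := hs p hp
        exact Filter.Eventually.and h₁ ((hU.eventually_ne p.1).and h₂)
      have hB' : ∀ᶠ x in U, ∀ᶠ m in U, x * m ∈ B := by
        rw [← Ultrafilter.eventually_mul U U (fun m => m ∈ B), hUU]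
        exact hB
      obtain ⟨x, hx, hx'⟩ := (hB'.and hB).exists
      exact ⟨(x, B), ⟨inter_subset_left, hx', hB, hx⟩, fun p hp m hm => hm.2 p hp⟩)
  have key (b : Stream' S) (m : S) (hm : m ∈ FP b) :
      ∀ n, (∀ i, b.get i = (f (n + i)).1) → m ∈ (f n).2 := by
    induction hm with
    | head' b =>
      intro n hb
      have : b.head = (f n).1 := hb 0
      rw [this]
      exact (hf n).2.1
    | tail' b m _ ih =>
      intro n hb
      refine (hr n (n + 1) n.lt_succ_self m (ih (n + 1) fun i => ?_)).1
      rw [Stream'.get_tail, hb, add_right_comm, add_assoc]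
    | cons' b m _ ih =>
      intro n hb
      have : b.head = (f n).1 := hb 0
      rw [this]
      refine (hr n (n + 1) n.lt_succ_self m (ih (n + 1) fun i => ?_)).2.2
      rw [Stream'.get_tail, hb, add_right_comm, add_assoc]
  refine ⟨fun n => (f n).1, ?_, fun m hm => (hf 0).1 (key _ m hm 0 fun i => ?_)⟩
  · have hne (i j : ℕ) (hij : i < j) : (f j).1 ≠ (f i).1 := (hr i j hij _ (hf j).2.1).2.1
    intro i j hij
    rcases lt_trichotomy i j with h | h | h
    · exact absurd hij.symm (hne i j h)
    · exact h
    · exact absurd hij (hne j i h)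
  · rw [zero_add]; rfl

/-- If a free ultrafilter has a principal square at an element of finite order, then every large set
contains a sequence of distinct elements with only finitely many further finite products. -/
theorem exists_injective_FP_diff_range_finite {U : Ultrafilter S} (hU : U.IsFree) {s : S}
    (hUU : U * U = pure s) (hs : (range fun n => (s * ·)^[n] s).Finite) {A : Set S} (hA : A ∈ U) :
    ∃ a : Stream' S, Function.Injective a.get ∧ range a.get ⊆ A ∧
      (FP a \ range a.get).Finite := by
  have hev := Ultrafilter.eventually_eventually_of_mul_eq_pure hUU
  have hts (x : S) (hx : ∀ᶠ y in U, x * y = s) : ∀ᶠ z in U, s * z = x * s := by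
    obtain ⟨y, hxy, hy⟩ := (hx.and hev).exists
    filter_upwards [hy] with z hz
    rw [← hxy, mul_assoc, hz, hxy]
  obtain ⟨x₀, hx₀⟩ := hev.exists
  obtain ⟨t, ht⟩ : ∃ t, ∀ᶠ z in U, s * z = t := ⟨_, hts x₀ hx₀⟩
  have ht' : ∀ x, (∀ᶠ y in U, x * y = s) → x * s = t := fun x hx => by
    obtain ⟨z, h₁, h₂⟩ := ((hts x hx).and ht).exists
    rw [← h₁, h₂]
  -- Left multiplication by an admissible x sends s to t and t to s², so it swaps the two families.
  set Q : Set S := (range fun n => (s * ·)^[n] s) ∪ range fun n => (s * ·)^[n] t with hQ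
  have hQfin : Q.Finite := by
    refine hs.union (((hs.image fun x => x * t).insert t).subset ?_)
    rintro _ ⟨n | n, rfl⟩
    · exact mem_insert _ _
    · exact mem_insert_of_mem _ ⟨_, ⟨n, rfl⟩, mul_left_iterate_self_mul s t n⟩
  have hmulQ (x : S) (hx : ∀ᶠ y in U, x * y = s) : ∀ q ∈ Q, x * q ∈ Q := by
    obtain ⟨y, hxy, hy⟩ := (hx.and hev).exists
    have hxt : x * t = s * s := by rw [← ht' y hy, ← mul_assoc, hxy]
    have hts : t * s = s * t := by
      obtain ⟨z, h₁, h₂⟩ := (ht.and hev).exists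
      rw [← h₁, mul_assoc, ht' z h₂, h₁]
    have htt : t * t = s * (s * s) := by
      obtain ⟨z, h₁, h₂⟩ := (ht.and hev).exists
      obtain ⟨w, h₃, h₄⟩ := (h₂.and hev).exists
      calc t * t = s * z * (w * s) := by rw [h₁, ht' w h₄]
        _ = s * (s * s) := by rw [mul_assoc, ← mul_assoc z, h₃]
    have hcomm (n : ℕ) (p : S) : t * (s * ·)^[n] p = (s * ·)^[n] (t * p) := by
      induction n generalizing p with
      | zero => rfl
      | succ n ih =>
        rw [Function.iterate_succ_apply, Function.iterate_succ_apply, ih, ← mul_assoc, hts,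
          mul_assoc]
    have hxs (n : ℕ) (p : S) : x * (s * ·)^[n + 1] p = (s * ·)^[n] (t * p) := by
      rw [Function.iterate_succ_apply', ← mul_assoc, ht' x hx, hcomm]
    rintro _ (⟨n | n, rfl⟩ | ⟨n | n, rfl⟩)
    · exact .inr ⟨0, (ht' x hx).symm⟩
    · exact .inr ⟨n + 1, by
        change (s * ·)^[n + 1] t = x * (s * ·)^[n + 1] s
        rw [hxs, hts, Function.iterate_succ_apply]⟩
    · exact .inl ⟨1, hxt.symm⟩
    · exact .inl ⟨n + 2, by
        change (s * ·)^[n + 2] s = x * (s * ·)^[n + 1] t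
        rw [hxs, htt, Function.iterate_succ_apply, Function.iterate_succ_apply]⟩
  obtain ⟨f, hf, hr⟩ := exists_seq_of_forall_finset_exists
    (fun x => x ∈ A ∧ ∀ᶠ y in U, x * y = s) (fun x y => y ≠ x ∧ x * y = s) (by
      intro F hF
      have h : ∀ᶠ y in U, ∀ x ∈ F, y ≠ x ∧ x * y = s :=
        (eventually_all_finset F).2 fun x hx => (hU.eventually_ne x).and (hF x hx).2
      obtain ⟨y, ⟨hyA, hy⟩, h⟩ := ((Eventually.and hA hev).and h).exists
      exact ⟨y, ⟨hyA, hy⟩, h⟩)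
  have key (b : Stream' S) (m : S) (hm : m ∈ FP b) :
      ∀ n, (∀ i, b.get i = f (n + i)) → (∃ i, n ≤ i ∧ m = f i) ∨ m ∈ Q := by
    induction hm with
    | head' b => exact fun n hb => .inl ⟨n, le_rfl, hb 0⟩
    | tail' b m _ ih =>
      intro n hb
      rcases ih (n + 1) (fun i => by rw [Stream'.get_tail, hb, add_right_comm, add_assoc])
        with ⟨i, hi, rfl⟩ | h
      · exact .inl ⟨i, by omega, rfl⟩
      · exact .inr h
    | cons' b m _ ih =>
      intro n hb
      have hb₀ : b.head = f n := hb 0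
      rw [hb₀]
      right
      rcases ih (n + 1) (fun i => by rw [Stream'.get_tail, hb, add_right_comm, add_assoc])
        with ⟨i, hi, rfl⟩ | h
      · rw [(hr n i hi).2]
        exact .inl ⟨0, rfl⟩
      · exact hmulQ _ (hf n).2 m h
  refine ⟨f, fun i j hij => ?_, ?_, hQfin.subset ?_⟩
  · change f i = f j at hij
    rcases lt_trichotomy i j with h | h | h
    · exact absurd hij.symm (hr i j h).1
    · exact h
    · exact absurd hij (hr j i h).1
  · rintro _ ⟨n, rfl⟩
    exact (hf n).1
  · rintro m ⟨hm, hm'⟩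
    rcases key _ m hm 0 (fun i => by rw [zero_add]; rfl) with ⟨i, -, rfl⟩ | h
    · exact absurd ⟨i, rfl⟩ hm'
    · exact h

theorem infinite_FP_of_injective {a : Stream' S} (ha : Function.Injective a.get) :
    (FP a).Infinite :=
  (infinite_range_of_injective ha).mono (range_subset_iff.2 (FP.singleton a))

end Hindman

theorem exists_color_mem_ultrafilter {S C : Type*} [Finite C] (U : Ultrafilter S) (χ : S → C) :
    ∃ c, χ ⁻¹' {c} ∈ U := by
  obtain ⟨c, hc⟩ := Ultrafilter.eq_pure_of_finite (U.map χ)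
  refine ⟨c, ?_⟩
  rw [← Ultrafilter.mem_map, hc]
  exact mem_pure.2 rfl

theorem theorem2p2 {S : Type*} [Semigroup S] [Infinite S] {C : Type*} [Finite C] (χ : S → C) :
    ∃ a : Stream' S, (∀ i j : ℕ, a.get i = a.get j → i = j) ∧
      (Hindman.FP a).Infinite ∧
      ∃ F : Set S, F.Finite ∧ F ⊆ Hindman.FP a ∧
        ∃ c : C, ∀ x ∈ Hindman.FP a \ F, χ x = c := by
  by_cases hid : ∃ U : Ultrafilter S, U.IsFree ∧ U * U = U
  · obtain ⟨U, hU, hUU⟩ := hid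
    obtain ⟨c, hc⟩ := exists_color_mem_ultrafilter U χ
    obtain ⟨a, ha, hac⟩ := Hindman.exists_injective_FP_subset hU hUU hc
    exact ⟨a, fun i j h => ha h, Hindman.infinite_FP_of_injective ha, ∅, finite_empty,
      empty_subset _, c, fun x hx => hac hx.1⟩
  · obtain ⟨U, hU, s, hs⟩ := (exists_isFree_idempotent_or_mul_self_eq_pure S).resolve_left hid
    obtain ⟨c, hc⟩ := exists_color_mem_ultrafilter U χ
    have hfin : (range fun n => (s * ·)^[n] s).Finite := by
      by_contra h
      exact hid (exists_isFree_idempotent_of_infinite_powers h)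
    obtain ⟨a, ha, hac, hF⟩ := Hindman.exists_injective_FP_diff_range_finite hU hs hfin hc
    refine ⟨a, fun i j h => ha h, Hindman.infinite_FP_of_injective ha, _, hF, sdiff_subset, c,
      fun x hx => hac ?_⟩
    by_contra h
    exact hx.2 ⟨hx.1, h⟩
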